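/- **Conventions.** Formulas are built from countably many variables with the connectives $\wedge,\vee,\cdot,\to,0,1$, and $\neg\varphi:=\varphi\to 0$. An $\mathrm{FL_e}$-algebra is an algebra $\mathbf A=\langle A,\wedge,\vee,\cdot,\to,0,1\rangle$ such that $\langle A,\wedge,\vee\rangle$ is a lattice, $\langle A,\cdot,1\rangle$ is a commutative monoid, $x\cdot y\le z\iff x\le y\to z$ for all $x,y,z\in A$, and $0\in A$ is an arbitrary constant; $\neg x:=x\to 0$. Put $$x\Rightarrow_\wedge y:=(x\to y)\wedge(y\to\neg\neg x),\qquad x\Rightarrow_\circ y:=(x\to y)\cdot(y\to\neg\neg x).$$ $\mathbf{FL_e}$ is the logic with $\Phi\vdash\psi$ iff the sequent $\vdash\psi$ is derivable, in the full Lambek sequent calculus with exchange (and cut), from the sequents $\vdash\varphi$, $\varphi\in\Phi$. A *substructural logic* $\mathbf L$ is an axiomatic extension of $\mathbf{FL_e}$: there is a set $\Delta$ of formulas closed under substitution such that $\Phi\vdash_{\mathbf L}\psi$ iff $\Phi\cup\Delta\vdash_{\mathbf{FL_e}}\psi$. $\mathsf V(\mathbf L)$ is the class of $\mathrm{FL_e}$-algebras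 in which $1\le\varphi$ holds under every valuation, for every theorem $\varphi$ of $\mathbf L$. For a binary operation $\Rightarrow$ on an $\mathrm{FL_e}$-algebra $\mathbf A$, the pair $(\mathbf A,\Rightarrow)$ is *proto-connexive* if for all $x,y\in A$ $$1\le\neg(x\Rightarrow\neg x),\quad 1\le\neg(\neg x\Rightarrow x),\quad 1\le(x\Rightarrow y)\Rightarrow\neg(x\Rightarrow\neg y),\quad 1\le(x\Rightarrow\neg y)\Rightarrow\neg(x\Rightarrow y),$$ and *connexive* if moreover $x\Rightarrow y\ne y\Rightarrow x$ for some $x,y\in A$. For $\Rightarrow\,\in\{\Rightarrow_\circ,\Rightarrow_\wedge\}$, $(\mathbf L,\Rightarrow)$ is *connexive* if $(\mathbf A,\Rightarrow)$ is proto-connexive for every $\mathbf A\in\mathsf V(\mathbf L)$ and connexive for at least one $\mathbf A\in\mathsf V(\mathbf L)$. A formula is *satisfied* in $\mathbf A$ under a valuation if its value is $\ge 1$. $\mathbf A$ *refutes* (K1) if for some formula $\varphi$ one of $\varphi\Rightarrow\neg\varphi$, $\neg\varphi\Rightarrow\varphi$ is satisfied in $\mathbf A$ under some valuation; $\mathbf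 A$ *refutes* (K2) if for some formulas $\varphi,\psi$ both $\varphi\Rightarrow\psi$ and $\varphi\Rightarrow\neg\psi$ are satisfied in $\mathbf A$ under the same valuation. $(\mathbf L,\Rightarrow)$ is *strongly connexive* if it is connexive and no nontrivial $\mathbf A\in\mathsf V(\mathbf L)$ refutes (K1) or (K2). **Theorem.** 1. Let $\Rightarrow\,\in\{\Rightarrow_\circ,\Rightarrow_\wedge\}$ and let $\mathbf L$ be a substructural logic such that $(\mathbf L,\Rightarrow)$ is connexive. Then $(\mathbf L,\Rightarrow)$ is strongly connexive if and only if $0\vdash_{\mathbf L}\varphi$ for every formula $\varphi$. 2. Let $\mathbf A$ be an $\mathrm{FL_e}$-algebra and $\Rightarrow\,\in\{\Rightarrow_\circ,\Rightarrow_\wedge\}$ such that $(\mathbf A,\Rightarrow)$ is proto-connexive. If $\mathbf A$ refutes (K1) or (K2) with respect to $\Rightarrow$, then $1\le 0$ in $\mathbf A$. 3. Let $\mathbf A$ be an $\mathrm{FL_e}$-algebra such that $(\mathbf A,\Rightarrow_\wedge)$ is proto-connexive. Then $\mathbf A$ refutes (K1) or (K2) with respect to $\Rightarrow_\wedge$ if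 and only if $x\le 0$ for all $x\in A$. -/

import Mathlib

universe u

namespace Connexive

/-- Formulas over `{∧, ∨, ·, →, 0, 1}` with countably many propositional variables. -/
inductive Fm : Type
  | var : ℕ → Fm
  | and : Fm → Fm → Fm
  | or : Fm → Fm → Fm
  | fus : Fm → Fm → Fm
  | imp : Fm → Fm → Fm
  | zero : Fm
  | one : Fm

/-- Negation `¬φ := φ → 0`. -/
def Fm.neg (φ : Fm) : Fm := Fm.imp φ Fm.zero

/-- The extension of a substitution to all formulas. -/
def Fm.subst (σ : ℕ → Fm) : Fm → Fm
  | Fm.var n => σ n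
  | Fm.and φ ψ => Fm.and (Fm.subst σ φ) (Fm.subst σ ψ)
  | Fm.or φ ψ => Fm.or (Fm.subst σ φ) (Fm.subst σ ψ)
  | Fm.fus φ ψ => Fm.fus (Fm.subst σ φ) (Fm.subst σ ψ)
  | Fm.imp φ ψ => Fm.imp (Fm.subst σ φ) (Fm.subst σ ψ)
  | Fm.zero => Fm.zero
  | Fm.one => Fm.one

/-- The sequent calculus `FLₑ` (full Lambek calculus with exchange), with initial sequents
`⊢ φ` for `φ ∈ H` added. Antecedents are finite multisets, so exchange is built in; the
succedent is empty (`none`) or a single formula. -/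
inductive SeqDer (H : Set Fm) : Multiset Fm → Option Fm → Prop
  | hyp (φ : Fm) : φ ∈ H → SeqDer H 0 (some φ)
  | init (φ : Fm) : SeqDer H {φ} (some φ)
  | cut (Γ S : Multiset Fm) (φ : Fm) (D : Option Fm) :
      SeqDer H Γ (some φ) → SeqDer H (φ ::ₘ S) D → SeqDer H (Γ + S) D
  | oneL (Γ : Multiset Fm) (D : Option Fm) : SeqDer H Γ D → SeqDer H (Fm.one ::ₘ Γ) D
  | oneR : SeqDer H 0 (some Fm.one)
  | zeroL : SeqDer H {Fm.zero} none
  | zeroR (Γ : Multiset Fm) : SeqDer H Γ none → SeqDer H Γ (some Fm.zero)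
  | andL₁ (Γ : Multiset Fm) (φ ψ : Fm) (D : Option Fm) :
      SeqDer H (φ ::ₘ Γ) D → SeqDer H (Fm.and φ ψ ::ₘ Γ) D
  | andL₂ (Γ : Multiset Fm) (φ ψ : Fm) (D : Option Fm) :
      SeqDer H (ψ ::ₘ Γ) D → SeqDer H (Fm.and φ ψ ::ₘ Γ) D
  | andR (Γ : Multiset Fm) (φ ψ : Fm) :
      SeqDer H Γ (some φ) → SeqDer H Γ (some ψ) → SeqDer H Γ (some (Fm.and φ ψ))
  | orL (Γ : Multiset Fm) (φ ψ : Fm) (D : Option Fm) :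
      SeqDer H (φ ::ₘ Γ) D → SeqDer H (ψ ::ₘ Γ) D → SeqDer H (Fm.or φ ψ ::ₘ Γ) D
  | orR₁ (Γ : Multiset Fm) (φ ψ : Fm) : SeqDer H Γ (some φ) → SeqDer H Γ (some (Fm.or φ ψ))
  | orR₂ (Γ : Multiset Fm) (φ ψ : Fm) : SeqDer H Γ (some ψ) → SeqDer H Γ (some (Fm.or φ ψ))
  | fusL (Γ : Multiset Fm) (φ ψ : Fm) (D : Option Fm) :
      SeqDer H (φ ::ₘ ψ ::ₘ Γ) D → SeqDer H (Fm.fus φ ψ ::ₘ Γ) D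
  | fusR (Γ S : Multiset Fm) (φ ψ : Fm) :
      SeqDer H Γ (some φ) → SeqDer H S (some ψ) → SeqDer H (Γ + S) (some (Fm.fus φ ψ))
  | impL (Γ S : Multiset Fm) (φ ψ : Fm) (D : Option Fm) :
      SeqDer H Γ (some φ) → SeqDer H (ψ ::ₘ S) D → SeqDer H (Fm.imp φ ψ ::ₘ (Γ + S)) D
  | impR (Γ : Multiset Fm) (φ ψ : Fm) :
      SeqDer H (φ ::ₘ Γ) (some ψ) → SeqDer H Γ (some (Fm.imp φ ψ))

/-- A logic: a structural consequence relation on formulas. -/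
structure Logic where
  entails : Set Fm → Fm → Prop
  refl' : ∀ (Φ : Set Fm) (φ : Fm), φ ∈ Φ → entails Φ φ
  mono' : ∀ (Φ Ψ : Set Fm) (φ : Fm), Φ ⊆ Ψ → entails Φ φ → entails Ψ φ
  trans' : ∀ (Φ Ψ : Set Fm) (φ : Fm), (∀ ψ ∈ Ψ, entails Φ ψ) → entails Ψ φ → entails Φ φ
  struct' : ∀ (σ : ℕ → Fm) (Φ : Set Fm) (φ : Fm),
    entails Φ φ → entails (Fm.subst σ '' Φ) (Fm.subst σ φ)

theorem SeqDer.trans {Φ Ψ : Set Fm} (h : ∀ ψ ∈ Ψ, SeqDer Φ 0 (some ψ)) {Γ : Multiset Fm}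
    {D : Option Fm} (hD : SeqDer Ψ Γ D) : SeqDer Φ Γ D := by
  induction hD with
  | hyp φ hφ => exact h φ hφ
  | init φ => exact .init φ
  | cut Γ S φ D _ _ ih₁ ih₂ => exact .cut Γ S φ D ih₁ ih₂
  | oneL Γ D _ ih => exact .oneL Γ D ih
  | oneR => exact .oneR
  | zeroL => exact .zeroL
  | zeroR Γ _ ih => exact .zeroR Γ ih
  | andL₁ Γ φ ψ D _ ih => exact .andL₁ Γ φ ψ D ih
  | andL₂ Γ φ ψ D _ ih => exact .andL₂ Γ φ ψ D ih
  | andR Γ φ ψ _ _ ih₁ ih₂ => exact .andR Γ φ ψ ih₁ ih₂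
  | orL Γ φ ψ D _ _ ih₁ ih₂ => exact .orL Γ φ ψ D ih₁ ih₂
  | orR₁ Γ φ ψ _ ih => exact .orR₁ Γ φ ψ ih
  | orR₂ Γ φ ψ _ ih => exact .orR₂ Γ φ ψ ih
  | fusL Γ φ ψ D _ ih => exact .fusL Γ φ ψ D ih
  | fusR Γ S φ ψ _ _ ih₁ ih₂ => exact .fusR Γ S φ ψ ih₁ ih₂
  | impL Γ S φ ψ D _ _ ih₁ ih₂ => exact .impL Γ S φ ψ D ih₁ ih₂
  | impR Γ φ ψ _ ih => exact .impR Γ φ ψ ih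

theorem SeqDer.subst (σ : ℕ → Fm) {Φ : Set Fm} {Γ : Multiset Fm} {D : Option Fm}
    (hD : SeqDer Φ Γ D) :
    SeqDer (Fm.subst σ '' Φ) (Γ.map (Fm.subst σ)) (D.map (Fm.subst σ)) := by
  induction hD with
  | hyp φ hφ => exact .hyp _ ⟨φ, hφ, rfl⟩
  | init φ => exact .init _
  | cut Γ S φ D _ _ ih₁ ih₂ =>
    rw [Multiset.map_add]
    rw [Multiset.map_cons] at ih₂
    exact .cut _ _ _ _ ih₁ ih₂
  | oneL Γ D _ ih => rw [Multiset.map_cons]; exact .oneL _ _ ih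
  | oneR => exact .oneR
  | zeroL => exact .zeroL
  | zeroR Γ _ ih => exact .zeroR _ ih
  | andL₁ Γ φ ψ D _ ih =>
    rw [Multiset.map_cons] at ih ⊢
    exact .andL₁ _ _ _ _ ih
  | andL₂ Γ φ ψ D _ ih =>
    rw [Multiset.map_cons] at ih ⊢
    exact .andL₂ _ _ _ _ ih
  | andR Γ φ ψ _ _ ih₁ ih₂ => exact .andR _ _ _ ih₁ ih₂
  | orL Γ φ ψ D _ _ ih₁ ih₂ =>
    rw [Multiset.map_cons] at ih₁ ih₂ ⊢
    exact .orL _ _ _ _ ih₁ ih₂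
  | orR₁ Γ φ ψ _ ih => exact .orR₁ _ _ _ ih
  | orR₂ Γ φ ψ _ ih => exact .orR₂ _ _ _ ih
  | fusL Γ φ ψ D _ ih =>
    rw [Multiset.map_cons, Multiset.map_cons] at ih
    rw [Multiset.map_cons]
    exact .fusL _ _ _ _ ih
  | fusR Γ S φ ψ _ _ ih₁ ih₂ => rw [Multiset.map_add]; exact .fusR _ _ _ _ ih₁ ih₂
  | impL Γ S φ ψ D _ _ ih₁ ih₂ =>
    rw [Multiset.map_cons] at ih₂
    rw [Multiset.map_cons, Multiset.map_add]
    exact .impL _ _ _ _ _ ih₁ ih₂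
  | impR Γ φ ψ _ ih =>
    rw [Multiset.map_cons] at ih
    exact .impR _ _ _ ih

/-- The external logic of the sequent calculus: `Φ ⊢ ψ` iff the sequent `⊢ ψ` is derivable
from the sequents `⊢ φ` with `φ ∈ Φ`. -/
def logicFLe : Logic where
  entails Φ ψ := SeqDer Φ 0 (some ψ)
  refl' _ φ h := .hyp φ h
  mono' _ _ _ hsub h := h.trans (fun φ hφ => .hyp φ (hsub hφ))
  trans' _ _ _ h hψ := hψ.trans h
  struct' σ _ _ h := h.subst σ

/-- Substructural logics: the axiomatic extensions of `logicFLe`, obtained by adding a set `Δ`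
of axioms closed under substitution. -/
def Logic.IsSubstructural (L : Logic) : Prop :=
  ∃ Δ : Set Fm, (∀ (σ : ℕ → Fm), ∀ δ ∈ Δ, Fm.subst σ δ ∈ Δ) ∧
    ∀ (Φ : Set Fm) (ψ : Fm), L.entails Φ ψ ↔ logicFLe.entails (Φ ∪ Δ) ψ

/-- Ex falso quodlibet: `0 ⊢ φ` for every formula `φ`. -/
def Logic.ExFalso (L : Logic) : Prop := ∀ φ : Fm, L.entails {Fm.zero} φ

/-- `FLₑ`-algebras: commutative residuated lattices with a constant `0` (on which nothing is
assumed); `x ⇨ y` is the residual, and `1` is the monoid unit. -/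
class FLeAlgebra (A : Type u) extends Lattice A, CommMonoid A, Zero A, HImp A where
  residuation : ∀ x y z : A, x * y ≤ z ↔ x ≤ y ⇨ z

/-- `¬x := x → 0`. -/
def neg {A : Type u} [FLeAlgebra A] (x : A) : A := x ⇨ 0

/-- The value of a formula under a valuation. -/
def Fm.eval {A : Type u} [FLeAlgebra A] (v : ℕ → A) : Fm → A
  | Fm.var n => v n
  | Fm.and φ ψ => Fm.eval v φ ⊓ Fm.eval v ψ
  | Fm.or φ ψ => Fm.eval v φ ⊔ Fm.eval v ψ
  | Fm.fus φ ψ => Fm.eval v φ * Fm.eval v ψ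
  | Fm.imp φ ψ => Fm.eval v φ ⇨ Fm.eval v ψ
  | Fm.zero => 0
  | Fm.one => 1

/-- Membership in `V(L)`: the algebra satisfies `1 ≤ φ` for every theorem `φ` of `L`. -/
def Logic.InVariety (L : Logic) (A : Type u) [FLeAlgebra A] : Prop :=
  ∀ φ : Fm, L.entails ∅ φ → ∀ v : ℕ → A, 1 ≤ Fm.eval v φ

/-- The two candidates for a connexive implication, `⇒∘` and `⇒∧`. -/
inductive Arrow : Type
  | fusion
  | meet

/-- `x ⇒∘ y = (x → y) · (y → ¬¬x)` and `x ⇒∧ y = (x → y) ∧ (y → ¬¬x)` in an algebra. -/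
def Arrow.op {A : Type u} [FLeAlgebra A] : Arrow → A → A → A
  | Arrow.fusion, x, y => (x ⇨ y) * (y ⇨ neg (neg x))
  | Arrow.meet, x, y => (x ⇨ y) ⊓ (y ⇨ neg (neg x))

/-- The same connectives as operations on formulas. -/
def Arrow.fm : Arrow → Fm → Fm → Fm
  | Arrow.fusion, φ, ψ => Fm.fus (Fm.imp φ ψ) (Fm.imp ψ φ.neg.neg)
  | Arrow.meet, φ, ψ => Fm.and (Fm.imp φ ψ) (Fm.imp ψ φ.neg.neg)

theorem Arrow.eval_fm {A : Type u} [FLeAlgebra A] (c : Arrow) (φ ψ : Fm) (v : ℕ → A) :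
    (c.fm φ ψ).eval v = c.op (φ.eval v) (ψ.eval v) := by
  cases c <;> rfl

/-- `(A, ⇒)` is proto-connexive: Aristotle's and Boethius' theses hold in `A`. -/
structure ProtoConnexive (A : Type u) [FLeAlgebra A] (r : A → A → A) : Prop where
  aristotle₁ : ∀ x : A, 1 ≤ neg (r x (neg x))
  aristotle₂ : ∀ x : A, 1 ≤ neg (r (neg x) x)
  boethius₁ : ∀ x y : A, 1 ≤ r (r x y) (neg (r x (neg y)))
  boethius₂ : ∀ x y : A, 1 ≤ r (r x (neg y)) (neg (r x y))

/-- `(A, ⇒)` is connexive: proto-connexive, and `⇒` is not symmetric. -/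
structure ConnexiveAlg (A : Type u) [FLeAlgebra A] (r : A → A → A) : Prop where
  proto : ProtoConnexive A r
  nonsymm : ∃ x y : A, ¬ r x y ≤ r y x ∨ ¬ r y x ≤ r x y

/-- `(L, ⇒)` is connexive: every member of `V(L)` is proto-connexive, and some member is
connexive. -/
structure Logic.IsConnexive (L : Logic) (c : Arrow) : Prop where
  proto : ∀ (A : Type u) [FLeAlgebra A], L.InVariety A → ProtoConnexive A (Arrow.op (A := A) c)
  witness : ∃ (A : Type u) (_ : FLeAlgebra A), L.InVariety A ∧ ConnexiveAlg A (Arrow.op (A := A) c)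

/-- Failure of (K1) in an algebra: some formula `φ ⇒ ¬φ`, or some formula `¬φ ⇒ φ`, is
satisfiable (takes a value above `1` under some valuation). -/
def RefutesK1 (A : Type u) [FLeAlgebra A] (c : Arrow) : Prop :=
  ∃ (φ : Fm) (v : ℕ → A),
    1 ≤ (c.fm φ φ.neg).eval v ∨ 1 ≤ (c.fm φ.neg φ).eval v

/-- Failure of (K2) in an algebra: some formulas `φ ⇒ ψ` and `φ ⇒ ¬ψ` are simultaneously
satisfiable. -/
def RefutesK2 (A : Type u) [FLeAlgebra A] (c : Arrow) : Prop :=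
  ∃ (φ ψ : Fm) (v : ℕ → A),
    1 ≤ (c.fm φ ψ).eval v ∧ 1 ≤ (c.fm φ ψ.neg).eval v

/-- `(L, ⇒)` is strongly connexive: connexive, and (K1) and (K2) hold in every model of `L`,
i.e. in every nontrivial member of `V(L)`. -/
structure Logic.IsStronglyConnexive (L : Logic) (c : Arrow) : Prop where
  connexive : Logic.IsConnexive.{u} L c
  k1 : ∀ (A : Type u) [FLeAlgebra A] [Nontrivial A], L.InVariety A → ¬ RefutesK1 A c
  k2 : ∀ (A : Type u) [FLeAlgebra A] [Nontrivial A], L.InVariety A → ¬ RefutesK2 A c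

end Connexive

/-!
A refutation of (K2) yields one of (K1), since `(x ⇒ y) · (x ⇒ ¬y) ≤ x ⇒ ¬x` in every
`FLₑ`-algebra, and Aristotle's theses bound the value of a refuted instance of (K1) by `0`. For
`⇒∧`, Boethius' thesis at `1` and `y` gives `y · y · 0 ≤ 0`; if `1 ≤ 0`, this makes `0` the greatest
element, as `x ≤ (x ∨ 1) · (x ∨ 1)`.

For `⇒∘` the inequality `1 ≤ 0` need not refute (K1) in the given algebra `A`, so let `A` be a
nontrivial member of `V(L)`, where `L` is strongly connexive, and suppose that `1 ≤ 0` in `A`. If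
`{0 → 1, 0}` derived a variable in `L`, then by the local deduction theorem a power of `(0 → 1) ∧ 1`
would lie below every element of `A`; its value is independent of the valuation because `0 → 1` has
no variables. So `A` would have a least element `b`, the values of `b ⇒ 1` and `b ⇒ ¬1` would
coincide, and Boethius' thesis would become a refutation of (K1). Otherwise, by algebraic
completeness, some nontrivial member of `V(L)` satisfies `0 = 1`, and there `1 ⇒ ¬1` refutes (K1).
Hence `1 ≤ 0` fails in every nontrivial member of `V(L)`, which is ex falso quodlibet for `L`.
-/

namespace Connexive

section Algebra

variable {A : Type u} [FLeAlgebra A] {x y z : A}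

instance : IsOrderedMonoid A where
  mul_le_mul_left x y hxy z := by
    rw [FLeAlgebra.residuation]
    exact hxy.trans ((FLeAlgebra.residuation _ _ _).1 le_rfl)

theorem le_himp_iff_mul_le : x ≤ y ⇨ z ↔ x * y ≤ z :=
  (FLeAlgebra.residuation x y z).symm

theorem himp_mul_le (x y : A) : (x ⇨ y) * x ≤ y :=
  le_himp_iff_mul_le.1 le_rfl

theorem one_le_himp_iff : 1 ≤ x ⇨ y ↔ x ≤ y := by
  rw [le_himp_iff_mul_le, one_mul]

theorem mul_himp (x y z : A) : x * y ⇨ z = x ⇨ y ⇨ z :=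
  eq_of_forall_le_iff fun w => by simp only [le_himp_iff_mul_le, mul_assoc]

theorem one_himp (x : A) : 1 ⇨ x = x :=
  eq_of_forall_le_iff fun w => by rw [le_himp_iff_mul_le, mul_one]

theorem himp_mul_himp_le (x y z : A) : (x ⇨ y) * (y ⇨ z) ≤ x ⇨ z := by
  rw [le_himp_iff_mul_le]
  calc (x ⇨ y) * (y ⇨ z) * x = (y ⇨ z) * ((x ⇨ y) * x) := by ac_rfl
    _ ≤ (y ⇨ z) * y := mul_le_mul_right (himp_mul_le x y) _
    _ ≤ z := himp_mul_le y z

theorem le_neg_iff_mul_le_zero : x ≤ neg y ↔ x * y ≤ 0 :=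
  le_himp_iff_mul_le

theorem one_le_neg_iff : 1 ≤ neg x ↔ x ≤ 0 :=
  one_le_himp_iff

theorem neg_one : neg (1 : A) = 0 :=
  one_himp 0

theorem himp_neg (x y : A) : x ⇨ neg y = neg (x * y) :=
  (mul_himp x y 0).symm

theorem himp_neg_comm (x y : A) : x ⇨ neg y = y ⇨ neg x := by
  rw [himp_neg, himp_neg, mul_comm]

theorem le_neg_comm : x ≤ neg y ↔ y ≤ neg x := by
  rw [le_neg_iff_mul_le_zero, le_neg_iff_mul_le_zero, mul_comm]

theorem le_neg_neg (x : A) : x ≤ neg (neg x) :=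
  le_neg_comm.1 le_rfl

theorem neg_le_neg (h : x ≤ y) : neg y ≤ neg x :=
  le_neg_comm.1 (h.trans (le_neg_neg y))

theorem neg_neg_neg (x : A) : neg (neg (neg x)) = neg x :=
  le_antisymm (neg_le_neg (le_neg_neg x)) (le_neg_neg (neg x))

theorem le_himp_of_isBot {b : A} (hb : IsBot b) (x y : A) : x ≤ b ⇨ y := by
  rw [le_himp_iff_mul_le, mul_comm, ← le_himp_iff_mul_le]
  exact hb _

end Algebra

section Arrow

variable {A : Type u} [FLeAlgebra A] {c : Arrow} {x y : A}

theorem Arrow.one_le_op (h₁ : x ≤ y) (h₂ : y ≤ neg (neg x)) : 1 ≤ c.op x y := by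
  rw [← one_le_himp_iff] at h₁ h₂
  cases c with
  | fusion => exact one_le_mul h₁ h₂
  | meet => exact le_inf h₁ h₂

theorem Arrow.op_mul_op_neg_le (c : Arrow) (x y : A) :
    c.op x y * c.op x (neg y) ≤ c.op x (neg x) := by
  have hx : (x ⇨ y) * (x ⇨ neg y) ≤ x ⇨ neg x := by
    rw [himp_neg_comm x y]
    exact himp_mul_himp_le x y (neg x)
  have hnx : (y ⇨ neg (neg x)) * (neg y ⇨ neg (neg x)) ≤ neg x ⇨ neg (neg x) := by
    rw [himp_neg_comm y (neg x)]
    exact himp_mul_himp_le (neg x) (neg y) (neg (neg x))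
  cases c with
  | fusion =>
    simp only [op]
    rw [mul_mul_mul_comm]
    exact mul_le_mul' hx hnx
  | meet =>
    exact le_inf ((mul_le_mul' inf_le_left inf_le_left).trans hx)
      ((mul_le_mul' inf_le_right inf_le_right).trans hnx)

theorem Arrow.op_neg_one_of_isBot (c : Arrow) {b : A} (hb : IsBot b) (h₀ : (1 : A) ≤ 0) :
    c.op b (neg 1) = c.op b 1 := by
  have himp_eq : b ⇨ neg 1 = b ⇨ 1 :=
    le_antisymm (le_himp_of_isBot hb _ _) (le_himp_of_isBot hb _ _)
  have zero_mul_neg : 0 * neg b = neg b :=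
    le_antisymm (le_himp_of_isBot hb _ _) (le_mul_of_one_le_left' h₀)
  have himp_neg_neg_eq : neg 1 ⇨ neg (neg b) = 1 ⇨ neg (neg b) := by
    rw [neg_one, himp_neg, zero_mul_neg, one_himp]
  cases c <;> simp only [op, himp_eq, himp_neg_neg_eq]

end Arrow

section Refutation

variable {A : Type u} [FLeAlgebra A] {c : Arrow}

theorem refutesK1_of_one_le_op_neg {x : A} (h : 1 ≤ c.op x (neg x)) : RefutesK1 A c :=
  ⟨.var 0, fun _ => x, .inl (by rwa [Arrow.eval_fm])⟩

theorem RefutesK2.refutesK1 (h : RefutesK2 A c) : RefutesK1 A c := by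
  obtain ⟨φ, ψ, v, h₁, h₂⟩ := h
  rw [Arrow.eval_fm] at h₁ h₂
  exact refutesK1_of_one_le_op_neg ((one_le_mul h₁ h₂).trans (c.op_mul_op_neg_le _ _))

theorem refutesK1_of_forall_le_zero (h : ∀ x : A, x ≤ 0) : RefutesK1 A c := by
  have le_neg (x y : A) : x ≤ neg y := le_neg_iff_mul_le_zero.2 (h _)
  exact refutesK1_of_one_le_op_neg (x := 1) (Arrow.one_le_op (le_neg _ _) (le_neg _ _))

theorem refutesK1_of_zero_eq_one (h : (0 : A) = 1) : RefutesK1 A c := by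
  have h_neg : neg (1 : A) = 1 := neg_one.trans h
  refine refutesK1_of_one_le_op_neg (x := 1) (Arrow.one_le_op ?_ ?_) <;> simp only [h_neg, le_refl]

namespace ProtoConnexive

theorem one_le_zero (h : ProtoConnexive A (Arrow.op c)) (hK : RefutesK1 A c) : (1 : A) ≤ 0 := by
  obtain ⟨φ, v, h₁ | h₁⟩ := hK <;> rw [Arrow.eval_fm] at h₁
  · exact h₁.trans (one_le_neg_iff.1 (h.aristotle₁ (φ.eval v)))
  · exact h₁.trans (one_le_neg_iff.1 (h.aristotle₂ (φ.eval v)))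

theorem mul_self_mul_zero_le (h : ProtoConnexive A (Arrow.op .meet)) (y : A) :
    y * y * 0 ≤ 0 := by
  have neg_op_le : neg (Arrow.meet.op 1 (neg y)) ≤ neg (neg (Arrow.meet.op 1 y)) :=
    one_le_himp_iff.1 ((h.boethius₁ 1 y).trans inf_le_right)
  have op_neg_le : Arrow.meet.op 1 (neg y) ≤ neg y := inf_le_left.trans (one_himp _).le
  have op_le : Arrow.meet.op 1 y ≤ neg (y * 0) := by
    rw [← neg_one, ← himp_neg]
    exact inf_le_right
  rw [mul_assoc, ← le_neg_iff_mul_le_zero]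
  calc y ≤ neg (neg y) := le_neg_neg y
    _ ≤ neg (Arrow.meet.op 1 (neg y)) := neg_le_neg op_neg_le
    _ ≤ neg (neg (Arrow.meet.op 1 y)) := neg_op_le
    _ ≤ neg (neg (neg (y * 0))) := neg_le_neg (neg_le_neg op_le)
    _ = neg (y * 0) := neg_neg_neg _

theorem le_zero (h : ProtoConnexive A (Arrow.op .meet)) (h₀ : (1 : A) ≤ 0) (x : A) : x ≤ 0 :=
  calc x ≤ x ⊔ 1 := le_sup_left
    _ ≤ (x ⊔ 1) * (x ⊔ 1) := le_mul_of_one_le_right' le_sup_right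
    _ ≤ (x ⊔ 1) * (x ⊔ 1) * 0 := le_mul_of_one_le_right' h₀
    _ ≤ 0 := h.mul_self_mul_zero_le _

theorem refutesK1_of_isBot (h : ProtoConnexive A (Arrow.op c)) (h₀ : (1 : A) ≤ 0) {b : A}
    (hb : IsBot b) : RefutesK1 A c := by
  have boethius := h.boethius₁ b 1
  rw [c.op_neg_one_of_isBot hb h₀] at boethius
  exact refutesK1_of_one_le_op_neg boethius

end ProtoConnexive

end Refutation

theorem add_add_replicate_add {α : Type*} (s t : Multiset α) (m n : ℕ) (a : α) :
    s + t + Multiset.replicate (m + n) a =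
      (s + Multiset.replicate m a) + (t + Multiset.replicate n a) := by
  rw [Multiset.replicate_add, add_add_add_comm]

namespace SeqDer

variable {H : Set Fm} {Γ : Multiset Fm} {φ ψ χ : Fm} {D : Option Fm}

theorem prod_eval_le {A : Type u} [FLeAlgebra A] {v : ℕ → A} (hH : ∀ φ ∈ H, 1 ≤ φ.eval v)
    (h : SeqDer H Γ D) : (Γ.map (Fm.eval v)).prod ≤ D.elim 0 (Fm.eval v) := by
  induction h <;>
    simp only [Multiset.map_cons, Multiset.prod_cons, Multiset.map_add, Multiset.prod_add,
      Multiset.map_zero, Multiset.prod_zero, Multiset.map_singleton, Multiset.prod_singleton,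
      Option.elim_some, Option.elim_none, Fm.eval, one_mul] at *
  case hyp φ hφ => exact hH φ hφ
  case init | oneR | zeroL => exact le_rfl
  case oneL ih | zeroR ih => exact ih
  case cut ih₁ ih₂ => exact (mul_le_mul_left ih₁ _).trans ih₂
  case andL₁ ih => exact (mul_le_mul_left inf_le_left _).trans ih
  case andL₂ ih => exact (mul_le_mul_left inf_le_right _).trans ih
  case andR ih₁ ih₂ => exact le_inf ih₁ ih₂
  case orL ih₁ ih₂ =>
    rw [← le_himp_iff_mul_le] at *
    exact sup_le ih₁ ih₂
  case orR₁ ih => exact ih.trans le_sup_left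
  case orR₂ ih => exact ih.trans le_sup_right
  case fusL ih => rwa [mul_assoc]
  case fusR ih₁ ih₂ => exact mul_le_mul' ih₁ ih₂
  case impL Γ S φ ψ D _ _ ih₁ ih₂ =>
    rw [← mul_assoc]
    exact (mul_le_mul_left ((mul_le_mul_right ih₁ _).trans (himp_mul_le _ _)) _).trans ih₂
  case impR ih => rwa [le_himp_iff_mul_le, mul_comm]

theorem one_le_eval {A : Type u} [FLeAlgebra A] {v : ℕ → A} (hH : ∀ φ ∈ H, 1 ≤ φ.eval v)
    (h : SeqDer H 0 (some φ)) : 1 ≤ φ.eval v :=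
  h.prod_eval_le hH

theorem add_replicate_and_one_of_le {m n : ℕ} (hmn : m ≤ n)
    (h : SeqDer H (Γ + Multiset.replicate m (φ.and .one)) D) :
    SeqDer H (Γ + Multiset.replicate n (φ.and .one)) D := by
  induction n, hmn using Nat.le_induction with
  | base => exact h
  | succ n _ ih =>
    rw [Multiset.replicate_succ, Multiset.add_cons]
    exact .andL₂ _ _ _ _ (.oneL _ _ ih)

theorem exists_add_replicate_and_one_common {Γ' : Multiset Fm} {D' : Option Fm}
    (h : ∃ n, SeqDer H (Γ + Multiset.replicate n (φ.and .one)) D)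
    (h' : ∃ n, SeqDer H (Γ' + Multiset.replicate n (φ.and .one)) D') :
    ∃ n, SeqDer H (Γ + Multiset.replicate n (φ.and .one)) D ∧
      SeqDer H (Γ' + Multiset.replicate n (φ.and .one)) D' := by
  obtain ⟨m, hm⟩ := h
  obtain ⟨n, hn⟩ := h'
  exact ⟨max m n, hm.add_replicate_and_one_of_le (le_max_left m n),
    hn.add_replicate_and_one_of_le (le_max_right m n)⟩

/-- The local deduction theorem. -/
theorem exists_add_replicate_and_one (h : SeqDer (insert χ H) Γ D) :
    ∃ n, SeqDer H (Γ + Multiset.replicate n (χ.and .one)) D := by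
  induction h with
  | hyp φ hφ =>
    obtain rfl | hφ := hφ
    · exact ⟨1, .andL₁ 0 _ _ _ (.init _)⟩
    · exact ⟨0, .hyp φ hφ⟩
  | init φ => exact ⟨0, .init φ⟩
  | oneR => exact ⟨0, .oneR⟩
  | zeroL => exact ⟨0, .zeroL⟩
  | zeroR _ _ ih => exact ih.imp fun _ => .zeroR _
  | orR₁ _ _ _ _ ih => exact ih.imp fun _ => .orR₁ _ _ _
  | orR₂ _ _ _ _ ih => exact ih.imp fun _ => .orR₂ _ _ _
  | andR _ _ _ _ _ ih₁ ih₂ =>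
    exact (exists_add_replicate_and_one_common ih₁ ih₂).imp fun _ h => .andR _ _ _ h.1 h.2
  | orL _ _ _ _ _ _ ih₁ ih₂ =>
    have ih := exists_add_replicate_and_one_common ih₁ ih₂
    simp only [Multiset.cons_add] at ih ⊢
    exact ih.imp fun _ h => .orL _ _ _ _ h.1 h.2
  | fusR _ _ _ _ _ _ ih₁ ih₂ =>
    obtain ⟨m, hm⟩ := ih₁
    obtain ⟨n, hn⟩ := ih₂
    exact ⟨m + n, add_add_replicate_add .. ▸ .fusR _ _ _ _ hm hn⟩
  | _ => ?_
  all_goals simp only [Multiset.cons_add] at *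
  case oneL ih => exact ih.imp fun _ => .oneL _ _
  case andL₁ ih => exact ih.imp fun _ => .andL₁ _ _ _ _
  case andL₂ ih => exact ih.imp fun _ => .andL₂ _ _ _ _
  case fusL ih => exact ih.imp fun _ => .fusL _ _ _ _
  case impR ih => exact ih.imp fun _ => .impR _ _ _
  case cut ih₁ ih₂ =>
    obtain ⟨m, hm⟩ := ih₁
    obtain ⟨n, hn⟩ := ih₂
    exact ⟨m + n, add_add_replicate_add .. ▸ .cut _ _ _ _ hm hn⟩
  case impL ih₁ ih₂ =>
    obtain ⟨m, hm⟩ := ih₁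
    obtain ⟨n, hn⟩ := ih₂
    exact ⟨m + n, add_add_replicate_add .. ▸ .impL _ _ _ _ _ hm hn⟩

theorem exists_isBot {A : Type u} [FLeAlgebra A] (hH : ∀ φ ∈ H, ∀ v : ℕ → A, 1 ≤ φ.eval v)
    (hχ : ∀ v w : ℕ → A, χ.eval v = χ.eval w) {k : ℕ}
    (h : SeqDer (insert χ H) 0 (some (.var k))) : ∃ b : A, IsBot b := by
  obtain ⟨n, hn⟩ := h.exists_add_replicate_and_one
  refine ⟨(χ.eval (fun _ => (1 : A)) ⊓ 1) ^ n, fun x => ?_⟩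
  rw [hχ _ fun _ => x]
  have hx := hn.prod_eval_le (v := fun _ => x) fun φ hφ => hH φ hφ _
  simpa only [zero_add, Multiset.map_replicate, Multiset.prod_replicate, Option.elim_some,
    Fm.eval] using hx

theorem trans_singleton (h₁ : SeqDer H {φ} (some ψ)) (h₂ : SeqDer H {ψ} (some χ)) :
    SeqDer H {φ} (some χ) :=
  .cut {φ} 0 ψ _ h₁ h₂

theorem one_cons_iff : SeqDer H (.one ::ₘ Γ) D ↔ SeqDer H Γ D :=
  ⟨fun h => zero_add Γ ▸ .cut 0 Γ .one D .oneR h, .oneL Γ D⟩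

theorem fus_cons_iff : SeqDer H (φ.fus ψ ::ₘ Γ) D ↔ SeqDer H (φ ::ₘ ψ ::ₘ Γ) D := by
  refine ⟨fun h => ?_, .fusL Γ φ ψ D⟩
  have fus : SeqDer H ({φ} + {ψ}) (some (φ.fus ψ)) := .fusR _ _ _ _ (.init φ) (.init ψ)
  simpa only [Multiset.singleton_add, Multiset.cons_add] using SeqDer.cut _ Γ _ D fus h

theorem imp_iff : SeqDer H Γ (some (φ.imp ψ)) ↔ SeqDer H (φ ::ₘ Γ) (some ψ) := by
  refine ⟨fun h => ?_, .impR Γ φ ψ⟩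
  have mp : SeqDer H (φ.imp ψ ::ₘ ({φ} + 0)) (some ψ) := .impL _ _ _ _ _ (.init φ) (.init ψ)
  rw [add_zero] at mp
  simpa only [Multiset.add_comm Γ, Multiset.singleton_add] using SeqDer.cut Γ {φ} _ _ h mp

theorem and_mono {φ' ψ' : Fm} (hφ : SeqDer H {φ} (some φ')) (hψ : SeqDer H {ψ} (some ψ')) :
    SeqDer H {φ.and ψ} (some (φ'.and ψ')) :=
  .andR _ _ _ (.andL₁ 0 _ _ _ hφ) (.andL₂ 0 _ _ _ hψ)

theorem or_mono {φ' ψ' : Fm} (hφ : SeqDer H {φ} (some φ')) (hψ : SeqDer H {ψ} (some ψ')) :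
    SeqDer H {φ.or ψ} (some (φ'.or ψ')) :=
  .orL 0 _ _ _ (.orR₁ _ _ _ hφ) (.orR₂ _ _ _ hψ)

theorem fus_mono {φ' ψ' : Fm} (hφ : SeqDer H {φ} (some φ')) (hψ : SeqDer H {ψ} (some ψ')) :
    SeqDer H {φ.fus ψ} (some (φ'.fus ψ')) :=
  .fusL 0 _ _ _ (.fusR {φ} {ψ} _ _ hφ hψ)

theorem imp_mono {φ' ψ' : Fm} (hφ : SeqDer H {φ'} (some φ)) (hψ : SeqDer H {ψ} (some ψ')) :
    SeqDer H {φ.imp ψ} (some (φ'.imp ψ')) :=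
  .impR _ _ _ (Multiset.cons_swap φ' _ 0 ▸ .impL {φ'} 0 _ _ _ hφ hψ)

end SeqDer

theorem Fm.subst_var (φ : Fm) : φ.subst .var = φ := by
  induction φ with
  | var | zero | one => rfl
  | and _ _ ih₁ ih₂ | or _ _ ih₁ ih₂ | fus _ _ ih₁ ih₂ | imp _ _ ih₁ ih₂ =>
    rw [Fm.subst, ih₁, ih₂]

/-- The formulas, preordered by derivability from `H`. The lift makes the Lindenbaum algebra below
available in the universe over which the members of a variety range. -/
def FmOver (_ : Set Fm) : Type u :=
  ULift.{u} Fm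

instance (H : Set Fm) : Preorder (FmOver.{u} H) where
  le φ ψ := SeqDer H {φ.down} (some ψ.down)
  le_refl φ := .init φ.down
  le_trans _ _ _ := .trans_singleton

/-- The Lindenbaum algebra of `H`: the formulas modulo interderivability from `H`. -/
abbrev Lindenbaum (H : Set Fm) : Type u :=
  Antisymmetrization (FmOver.{u} H) (· ≤ ·)

namespace Lindenbaum

variable {H : Set Fm}

/-- The class of a formula in the Lindenbaum algebra. -/
def mk (H : Set Fm) (φ : Fm) : Lindenbaum.{u} H :=
  toAntisymmetrization (· ≤ ·) (ULift.up φ : FmOver.{u} H)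

theorem mk_surjective : Function.Surjective (mk.{u} H) := by
  rintro ⟨⟨φ⟩⟩
  exact ⟨φ, rfl⟩

/-- The operation on classes induced by a binary connective that respects derivability in
both directions. -/
def map₂ (f : Fm → Fm → Fm)
    (hf : ∀ {φ φ' ψ ψ' : Fm}, SeqDer H {φ'} (some φ) → SeqDer H {φ} (some φ') →
      SeqDer H {ψ} (some ψ') → SeqDer H {f φ ψ} (some (f φ' ψ'))) :
    Lindenbaum.{u} H → Lindenbaum.{u} H → Lindenbaum.{u} H :=
  Quotient.map₂ (fun φ ψ => ⟨f φ.down ψ.down⟩)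
    fun _ _ hφ _ _ hψ => ⟨hf hφ.2 hφ.1 hψ.1, hf hφ.1 hφ.2 hψ.2⟩

instance : Mul (Lindenbaum.{u} H) := ⟨map₂ Fm.fus fun _ => SeqDer.fus_mono⟩

instance : One (Lindenbaum.{u} H) := ⟨mk H .one⟩

theorem mk_eq_mk {φ ψ : Fm} (h : ∀ χ : Fm, SeqDer H {φ} (some χ) ↔ SeqDer H {ψ} (some χ)) :
    mk.{u} H φ = mk H ψ :=
  eq_of_forall_ge_iff <| mk_surjective.forall.2 h

instance : Lattice (Lindenbaum.{u} H) where
  inf := map₂ Fm.and fun _ => SeqDer.and_mono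
  sup := map₂ Fm.or fun _ => SeqDer.or_mono
  inf_le_left := by rintro ⟨⟨φ⟩⟩ ⟨⟨ψ⟩⟩; exact SeqDer.andL₁ 0 _ _ _ (.init φ)
  inf_le_right := by rintro ⟨⟨φ⟩⟩ ⟨⟨ψ⟩⟩; exact SeqDer.andL₂ 0 _ _ _ (.init ψ)
  le_inf := by rintro ⟨⟨φ⟩⟩ ⟨⟨ψ⟩⟩ ⟨⟨χ⟩⟩; exact SeqDer.andR _ _ _
  le_sup_left := by rintro ⟨⟨φ⟩⟩ ⟨⟨ψ⟩⟩; exact SeqDer.orR₁ _ _ _ (.init φ)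
  le_sup_right := by rintro ⟨⟨φ⟩⟩ ⟨⟨ψ⟩⟩; exact SeqDer.orR₂ _ _ _ (.init ψ)
  sup_le := by rintro ⟨⟨φ⟩⟩ ⟨⟨ψ⟩⟩ ⟨⟨χ⟩⟩; exact SeqDer.orL 0 _ _ _

instance : CommMonoid (Lindenbaum.{u} H) where
  mul_comm := by
    rintro ⟨⟨φ⟩⟩ ⟨⟨ψ⟩⟩
    refine mk_eq_mk fun χ => ?_
    simp only [← Multiset.cons_zero, SeqDer.fus_cons_iff, Multiset.cons_swap φ ψ]
  mul_assoc := by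
    rintro ⟨⟨φ₁⟩⟩ ⟨⟨φ₂⟩⟩ ⟨⟨φ₃⟩⟩
    refine mk_eq_mk fun χ => ?_
    simp only [← Multiset.cons_zero, SeqDer.fus_cons_iff, Multiset.cons_swap φ₁ (φ₂.fus φ₃),
      Multiset.cons_swap φ₁ φ₂, Multiset.cons_swap φ₁ φ₃]
  one_mul := by
    rintro ⟨⟨φ⟩⟩
    refine mk_eq_mk fun χ => ?_
    simp only [← Multiset.cons_zero, SeqDer.fus_cons_iff, SeqDer.one_cons_iff]
  mul_one := by
    rintro ⟨⟨φ⟩⟩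
    refine mk_eq_mk fun χ => ?_
    simp only [← Multiset.cons_zero, SeqDer.fus_cons_iff, SeqDer.one_cons_iff,
      Multiset.cons_swap φ .one]

instance : FLeAlgebra (Lindenbaum.{u} H) where
  zero := mk H .zero
  himp := map₂ Fm.imp fun hφ _ => SeqDer.imp_mono hφ
  residuation := by
    rintro ⟨⟨φ⟩⟩ ⟨⟨ψ⟩⟩ ⟨⟨χ⟩⟩
    change SeqDer H {φ.fus ψ} (some χ) ↔ SeqDer H {φ} (some (ψ.imp χ))
    rw [SeqDer.imp_iff, ← Multiset.cons_zero, SeqDer.fus_cons_iff, Multiset.cons_swap,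
      Multiset.cons_zero]

theorem one_le_mk_iff {φ : Fm} : 1 ≤ mk.{u} H φ ↔ SeqDer H 0 (some φ) :=
  SeqDer.one_cons_iff

theorem eval_mk (σ : ℕ → Fm) (φ : Fm) :
    φ.eval (fun n => mk.{u} H (σ n)) = mk H (φ.subst σ) := by
  induction φ with
  | var | zero | one => rfl
  | and _ _ ih₁ ih₂ | or _ _ ih₁ ih₂ | fus _ _ ih₁ ih₂ | imp _ _ ih₁ ih₂ =>
    rw [Fm.eval, ih₁, ih₂]
    rfl

end Lindenbaum

namespace Logic

variable {L : Logic}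

theorem inVariety_lindenbaum {H : Set Fm} (hH : ∀ φ, L.entails ∅ φ → SeqDer H 0 (some φ)) :
    L.InVariety (Lindenbaum.{u} H) := by
  intro φ hφ v
  obtain ⟨σ, rfl⟩ : ∃ σ : ℕ → Fm, (fun n => Lindenbaum.mk H (σ n)) = v :=
    ⟨_, funext fun n => Function.surjInv_eq Lindenbaum.mk_surjective (v n)⟩
  rw [Lindenbaum.eval_mk, Lindenbaum.one_le_mk_iff]
  have hσφ := L.struct' σ ∅ φ hφ
  rw [Set.image_empty] at hσφ
  exact hH _ hσφ

theorem IsSubstructural.entails_iff (hL : L.IsSubstructural) {Φ : Set Fm} {ψ : Fm} :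
    L.entails Φ ψ ↔ ∀ (A : Type u) [FLeAlgebra A], L.InVariety A → ∀ v : ℕ → A,
      (∀ φ ∈ Φ, 1 ≤ φ.eval v) → 1 ≤ ψ.eval v := by
  obtain ⟨Δ, -, hΔ⟩ := hL
  constructor
  · intro h A _ hA v hΦ
    refine ((hΔ Φ ψ).1 h).one_le_eval ?_
    rintro φ (hφ | hφ)
    · exact hΦ φ hφ
    · exact hA φ ((hΔ ∅ φ).2 (.hyp φ (.inr hφ))) v
  · intro h
    have hV : L.InVariety (Lindenbaum.{u} (Φ ∪ Δ)) := inVariety_lindenbaum fun φ hφ =>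
      (hΔ Φ φ).1 (L.mono' ∅ Φ φ (Set.empty_subset Φ) hφ)
    have one_le_iff (φ : Fm) : 1 ≤ φ.eval (fun n => Lindenbaum.mk.{u} (Φ ∪ Δ) (.var n)) ↔
        L.entails Φ φ := by
      rw [Lindenbaum.eval_mk, Fm.subst_var, Lindenbaum.one_le_mk_iff]
      exact (hΔ Φ φ).symm
    exact (one_le_iff ψ).1 (h _ hV _ fun φ hφ => (one_le_iff φ).2 (L.refl' Φ φ hφ))

theorem IsSubstructural.exFalso_iff (hL : L.IsSubstructural) :
    L.ExFalso ↔ ∀ (A : Type u) [FLeAlgebra A] [Nontrivial A], L.InVariety A → ¬ (1 : A) ≤ 0 := by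
  constructor
  · intro h A _ _ hA h₀
    have one_le (x : A) : 1 ≤ x :=
      hL.entails_iff.1 (h (.var 0)) A hA (fun _ => x) (by rintro _ rfl; exact h₀)
    exact not_subsingleton A
      ⟨fun x y => le_antisymm (one_le_himp_iff.1 (one_le _)) (one_le_himp_iff.1 (one_le _))⟩
  · intro h φ
    refine hL.entails_iff.2 fun A _ hA v h₀ => ?_
    by_contra hφ
    have : Nontrivial A := nontrivial_of_ne _ _ (mt le_of_eq hφ)
    exact h A hA (h₀ .zero rfl)

theorem IsSubstructural.exists_isBot (hL : L.IsSubstructural) {A : Type u} [FLeAlgebra A]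
    (hA : L.InVariety A) (h₀ : (1 : A) ≤ 0) {k : ℕ}
    (h : L.entails {Fm.zero.imp .one, .zero} (.var k)) : ∃ b : A, IsBot b := by
  obtain ⟨Δ, -, hΔ⟩ := hL
  rw [hΔ, Set.insert_union] at h
  refine SeqDer.exists_isBot ?_ (fun _ _ => rfl) h
  rintro φ (rfl | hφ) v
  · exact h₀
  · exact hA φ ((hΔ ∅ φ).2 (.hyp φ (.inr hφ))) v

theorem IsStronglyConnexive.not_one_le_zero {c : Arrow} (h : IsStronglyConnexive.{u} L c)
    (hL : L.IsSubstructural) (A : Type u) [FLeAlgebra A] [Nontrivial A] (hA : L.InVariety A) :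
    ¬ (1 : A) ≤ 0 := by
  intro h₀
  have consistent : ¬ L.entails {Fm.zero.imp .one, .zero} (.var 0) := fun h_entails =>
    have ⟨_, hb⟩ := hL.exists_isBot hA h₀ h_entails
    h.k1 A hA ((h.connexive.proto A hA).refutesK1_of_isBot h₀ hb)
  refine consistent (hL.entails_iff.2 fun B _ hB v hv => ?_)
  have zero_eq_one : (0 : B) = 1 :=
    le_antisymm (one_le_himp_iff.1 (hv (Fm.zero.imp .one) (.inl rfl))) (hv .zero (.inr rfl))
  by_contra hv₀
  have : Nontrivial B := nontrivial_of_ne _ _ (mt le_of_eq hv₀)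
  exact h.k1 B hB (refutesK1_of_zero_eq_one zero_eq_one)

theorem IsConnexive.isStronglyConnexive {c : Arrow} (hc : IsConnexive.{u} L c)
    (h : ∀ (A : Type u) [FLeAlgebra A] [Nontrivial A], L.InVariety A → ¬ (1 : A) ≤ 0) :
    IsStronglyConnexive.{u} L c where
  connexive := hc
  k1 A _ _ hA hK := h A hA ((hc.proto A hA).one_le_zero hK)
  k2 A _ _ hA hK := h A hA ((hc.proto A hA).one_le_zero hK.refutesK1)

end Logic

end Connexive

theorem mainTheorem12 :
    (∀ (c : Connexive.Arrow) (L : Connexive.Logic), L.IsSubstructural →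
      Connexive.Logic.IsConnexive.{u} L c →
      (Connexive.Logic.IsStronglyConnexive.{u} L c ↔ L.ExFalso)) ∧
    (∀ (A : Type u) [Connexive.FLeAlgebra A] (c : Connexive.Arrow),
      Connexive.ProtoConnexive A (Connexive.Arrow.op (A := A) c) →
      (Connexive.RefutesK1 A c ∨ Connexive.RefutesK2 A c) → (1 : A) ≤ 0) ∧
    (∀ (A : Type u) [Connexive.FLeAlgebra A],
      Connexive.ProtoConnexive A (Connexive.Arrow.op (A := A) Connexive.Arrow.meet) →
      ((Connexive.RefutesK1 A Connexive.Arrow.meet ∨ Connexive.RefutesK2 A Connexive.Arrow.meet) ↔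
        ∀ x : A, x ≤ 0)) := by
  refine ⟨fun c L hL hc => ?_, fun A _ c hA hK => ?_, fun A _ hA => ⟨fun hK => ?_, fun hA₀ => ?_⟩⟩
  · rw [hL.exFalso_iff]
    exact ⟨fun h => h.not_one_le_zero hL, hc.isStronglyConnexive⟩
  · exact hA.one_le_zero (hK.elim id Connexive.RefutesK2.refutesK1)
  · exact hA.le_zero (hA.one_le_zero (hK.elim id Connexive.RefutesK2.refutesK1))
  · exact .inl (Connexive.refutesK1_of_forall_le_zero hA₀)
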